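/- All graphs are finite, simple and have at least one vertex. For a graph $G$, let $\gamma(G)$ be its domination number (the minimum size of a set $D\subseteq V(G)$ such that every vertex belongs to $D$ or has a neighbor in $D$), let $\alpha_2(G)$ be its $2$-independence number (the maximum size of a set of vertices whose distinct elements are pairwise at distance greater than $2$, where vertices in different components have infinite distance), and let $\alpha(G)$ be its independence number. The average degree of $G$ is $2|E(G)|/|V(G)|$, and its maximum average degree is the maximum of the average degrees of its (nonempty) subgraphs. For a real number $d$, let $\mathcal{G}_d$ be the class of graphs of maximum average degree at most $d$. A cascade is a pair $(H,\psi)$, where $\psi$ is a proper coloring of a graph $H$ by the colors $\mathtt{v},\mathtt{e},\mathtt{d}$ such that every vertex of color $\mathtt{e}$ has exactly two neighbors of color $\mathtt{v}$ and exactly one neighbor of color $\mathtt{d}$, and $H$ has no other edges. Its foundation is the graph $F$ with vertex set $\psi^{-1}(\mathtt{v})$ in which two distinct vertices are adjacent if and only if they have a common neighbor in $H$, and its slope is $|\psi^{-1}(\mathtt{v})|/\max(\alpha(F),|\psi^{-1}(\mathtt{d})|)$. For $n\ge 4$, let $K'_n$ be the graph obtained from the clique $K_n$ by subdividing every edge exactly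 once and adding one vertex adjacent to all the subdivision vertices (and to no others). Then for every real number $d$: 1. If $d<6$, then $\mathcal{G}_d$ has bounded domination-to-$2$-independence ratio, i.e., $\gamma(G)/\alpha_2(G)$ is bounded from above over all $G\in\mathcal{G}_d$; moreover, every cascade $(H,\psi)$ with $H\in\mathcal{G}_d$ has slope at most $\frac{24}{6-d}-3$. 2. If $d\ge 6$, then $\mathcal{G}_d$ does not have domination tied to $2$-independence, i.e., there is no function $h$ such that $\gamma(G)\le h(\alpha_2(G))$ for every $G\in\mathcal{G}_d$; this is witnessed by the graphs $K'_n$: for every integer $n\ge 4$, we have $K'_n\in\mathcal{G}_d$, $\alpha_2(K'_n)=2$ and $\gamma(K'_n)\ge n/2$. -/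

import Mathlib

/-- A finite nonempty graph, together with its vertex type. -/
structure FinGraph where
  V : Type
  [finite : Finite V]
  [nonempty : Nonempty V]
  graph : SimpleGraph V

namespace SimpleGraph

variable {V : Type}

/-- Every vertex belongs to `D` or has a neighbor in `D`. -/
def IsDominatingSet (G : SimpleGraph V) (D : Finset V) : Prop :=
  ∀ v, v ∈ D ∨ ∃ u ∈ D, G.Adj v u

/-- The domination number: the minimum size of a dominating set (of a finite graph). -/
noncomputable def dominationNumber (G : SimpleGraph V) : ℕ :=
  sInf {n | ∃ D : Finset V, G.IsDominatingSet D ∧ D.card = n}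

/-- Any two distinct vertices of `A` are at distance greater than two; vertices in different
components are at distance `⊤`. -/
def IsTwoIndepSet (G : SimpleGraph V) (A : Finset V) : Prop :=
  ∀ u ∈ A, ∀ v ∈ A, u ≠ v → 2 < G.edist u v

/-- The 2-independence number: the maximum size of a 2-independent set (of a finite graph). -/
noncomputable def twoIndepNumber (G : SimpleGraph V) : ℕ :=
  sSup {n | ∃ A : Finset V, G.IsTwoIndepSet A ∧ A.card = n}

/-- The average degree `2 |E(G)| / |V(G)|` of a finite nonempty graph. -/
noncomputable def avgDegree (G : SimpleGraph V) : ℝ :=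
  2 * (G.edgeSet.ncard : ℝ) / (Nat.card V : ℝ)

/-- The maximum average degree: the maximum of the average degrees of the nonempty subgraphs.
A finite nonempty graph has finitely many of them, and at least one, so that the supremum is a
maximum. -/
noncomputable def maxAvgDegree (G : SimpleGraph V) : ℝ :=
  sSup {x | ∃ S : G.Subgraph, S.verts.Nonempty ∧ S.coe.avgDegree = x}

/-- The 1-subdivision: every edge is subdivided exactly once. The vertices are the old vertices
and one subdivision vertex for each edge, adjacent to the two ends of that edge. -/
def oneSubdivision (F : SimpleGraph V) : SimpleGraph (V ⊕ F.edgeSet) where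
  Adj
    | .inl v, .inr e => v ∈ e.1
    | .inr e, .inl v => v ∈ e.1
    | _, _ => False
  symm := ⟨by rintro (u | e) (v | f) h <;> exact h⟩
  loopless := ⟨by rintro (u | e) h <;> exact h⟩

/-- The graph `G` with one new vertex `none`, adjacent exactly to the vertices in `S`. -/
def addVertex (G : SimpleGraph V) (S : Set V) : SimpleGraph (Option V) where
  Adj
    | some u, some v => G.Adj u v
    | some u, none => u ∈ S
    | none, some v => v ∈ S
    | none, none => False
  symm := ⟨by
    rintro (_ | u) (_ | v) h
    · exact h
    · exact h
    · exact h
    · exact SimpleGraph.Adj.symm (G := G) h⟩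
  loopless := ⟨by
    rintro (_ | u) h
    · exact h
    · exact G.irrefl h⟩

end SimpleGraph

/-- The 1-subdivision of the clique on `n` vertices, plus one vertex adjacent to all the
subdivision vertices. -/
def subdividedCliqueApex (n : ℕ) : FinGraph where
  V := Option (Fin n ⊕ (⊤ : SimpleGraph (Fin n)).edgeSet)
  graph := (⊤ : SimpleGraph (Fin n)).oneSubdivision.addVertex (Set.range Sum.inr)

/-- The class of graphs of maximum average degree at most `d`. -/
def maxAvgDegreeClass (d : ℝ) : Set FinGraph :=
  {G | G.graph.maxAvgDegree ≤ d}

/-- The ratios `γ(G) / α₂(G)` for `G` in the class are bounded. -/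
def HasBoundedDominationRatio (𝒢 : Set FinGraph) : Prop :=
  BddAbove {r : ℝ | ∃ G ∈ 𝒢,
    r = (G.graph.dominationNumber : ℝ) / (G.graph.twoIndepNumber : ℝ)}

/-- The domination number is bounded by a function of the 2-independence number on the class. -/
def HasDominationTied (𝒢 : Set FinGraph) : Prop :=
  ∃ h : ℕ → ℝ, ∀ G ∈ 𝒢, (G.graph.dominationNumber : ℝ) ≤ h G.graph.twoIndepNumber

/-- The three colors used in a cascade. -/
inductive CascadeColor
  | v
  | e
  | d

/-- A coloring `color` that makes `H` into a cascade: the coloring is proper, every vertex of color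
`e` has exactly two neighbors of color `v` and exactly one neighbor of color `d`, and there are
no other edges. -/
structure Cascade {V : Type} (H : SimpleGraph V) where
  color : H.Coloring CascadeColor
  two_v : ∀ x, color x = .e → {y | H.Adj x y ∧ color y = .v}.ncard = 2
  one_d : ∀ x, color x = .e → {y | H.Adj x y ∧ color y = .d}.ncard = 1
  no_other : ∀ x y, H.Adj x y → color x = .e ∨ color y = .e

namespace Cascade

variable {V : Type} {H : SimpleGraph V}

/-- The foundation: the graph on the vertices of color `v`, where two distinct vertices are
adjacent if and only if they have a common neighbor. -/
def foundation (C : Cascade H) : SimpleGraph {x : V // C.color x = .v} where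
  Adj x y := x ≠ y ∧ ∃ z, H.Adj x z ∧ H.Adj y z
  symm := ⟨fun _ _ ⟨hne, z, hx, hy⟩ => ⟨hne.symm, z, hy, hx⟩⟩
  loopless := ⟨fun _ h => h.1 rfl⟩

/-- The slope: the number of vertices of color `v`, divided by the maximum of the independence
number of the foundation and the number of vertices of color `d`. -/
noncomputable def slope (C : Cascade H) : ℝ :=
  ({x | C.color x = .v}.ncard : ℝ) /
    (max C.foundation.indepNum {x | C.color x = .d}.ncard : ℕ)

end Cascade

/-! # Domination and 2-independence in graphs of bounded maximum average degree

Let `G` have maximum average degree at most `d < 6`. Then `G` is 5-degenerate, and a greedy pass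
along a degeneracy order (`exists_scattered_dominating`) yields a dominating set `D` and a set
`X ⊆ D` with `|D| ≤ 6 |X|` such that every closed neighborhood has at most six elements in `X`. A
second pass, over the vertices that are dominated only from `X`, makes `X` and `D` disjoint, at the
price of a constant factor and of `D` dominating only the vertices outside `X`
(`exists_scattered_disjoint_dominating`). Now let `W` be the set of the vertices outside `X ∪ D`
with at least two neighbors in `X`. Each of them also has a neighbor in `D`, so that
`G[X ∪ D ∪ W]` has at least `3 |W|` edges, and `d < 6` bounds `|W|` linearly in `|X|`
(`six_mul_card_le`). Any two vertices of `X` at distance at most two lie in the closed neighborhood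
of a vertex of `X ∪ D ∪ W`, so there are only linearly many such pairs
(`sum_card_nbrsIn_distTwoGraph_le`), and Turán's bound (`exists_isIndepSet_sq_card_le`) gives a
2-independent subset of `X` of linear size.

The slope of a cascade is bounded by the same two ingredients: the edge count bounds the number `m`
of vertices of color `e`, and the foundation has at most `m` edges, so that Turán's bound applies.

For `d ≥ 6`, every edge of `K'_n` has an end of degree three, which bounds the average degree of
every subgraph by six; two vertices on the same side of the bipartition into subdivision vertices and
other vertices are at distance two, while each vertex dominates at most two of the `n` clique
vertices.
-/

namespace SimpleGraph

/-! ### Neighbors in a finite set -/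

open scoped Classical in
/-- The neighbors of `v` in the finite set `S`. -/
noncomputable def nbrsIn {V : Type} (G : SimpleGraph V) (S : Finset V) (v : V) : Finset V :=
  {u ∈ S | G.Adj v u}

section

variable {V : Type} {G : SimpleGraph V}

@[simp] theorem mem_nbrsIn {S : Finset V} {u v : V} :
    u ∈ G.nbrsIn S v ↔ u ∈ S ∧ G.Adj v u := by
  simp [nbrsIn]

theorem nbrsIn_subset (S : Finset V) (v : V) : G.nbrsIn S v ⊆ S :=
  fun _ hu => (mem_nbrsIn.1 hu).1

theorem nbrsIn_mono {S T : Finset V} (h : S ⊆ T) (v : V) : G.nbrsIn S v ⊆ G.nbrsIn T v :=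
  fun _ hu => mem_nbrsIn.2 ⟨h (mem_nbrsIn.1 hu).1, (mem_nbrsIn.1 hu).2⟩

theorem sum_card_nbrsIn_comm (S T : Finset V) :
    ∑ v ∈ S, (G.nbrsIn T v).card = ∑ v ∈ T, (G.nbrsIn S v).card := by
  classical
  have := Finset.sum_card_bipartiteAbove_eq_sum_card_bipartiteBelow (s := S) (t := T) G.Adj
  simp only [Finset.bipartiteAbove, Finset.bipartiteBelow] at this
  convert this using 3 with v _ v _
  · ext u; simp
  · ext u; simp [G.adj_comm]

/-! ### Maximum average degree -/

theorem avgDegree_mul_card [Finite V] [Nonempty V] (G : SimpleGraph V) :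
    G.avgDegree * Nat.card V = 2 * (G.edgeSet.ncard : ℝ) := by
  have : (Nat.card V : ℝ) ≠ 0 := by exact_mod_cast Nat.card_pos.ne'
  rw [avgDegree, div_mul_cancel₀ _ this]

theorem avgDegree_le_maxAvgDegree [Finite V] (S : G.Subgraph) (hS : S.verts.Nonempty) :
    S.coe.avgDegree ≤ G.maxAvgDegree := by
  refine le_csSup (Set.Finite.bddAbove ?_) ⟨S, hS, rfl⟩
  refine (Set.finite_range fun S : G.Subgraph => S.coe.avgDegree).subset ?_
  rintro x ⟨S, -, rfl⟩
  exact ⟨S, rfl⟩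

/-- The sum of the degrees of the subgraph induced by `S` is at most `d * |S|`. -/
theorem sum_card_nbrsIn_le [Finite V] {d : ℝ} (hG : G.maxAvgDegree ≤ d) (S : Finset V) :
    ((∑ v ∈ S, (G.nbrsIn S v).card : ℕ) : ℝ) ≤ d * S.card := by
  classical
  rcases S.eq_empty_or_nonempty with rfl | hS
  · simp
  have := Fintype.ofFinite V
  set K : G.Subgraph := (⊤ : G.Subgraph).induce S
  have hv : K.verts = S := rfl
  have hne : Nonempty K.verts := by rw [hv]; exact hS.to_subtype
  have h1 := (avgDegree_le_maxAvgDegree K (by rw [hv]; exact hS)).trans hG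
  have h2 := avgDegree_mul_card K.coe
  have h3 : Nat.card K.verts = S.card := by rw [hv]; simp
  have h4 : ∑ v ∈ S, (G.nbrsIn S v).card = 2 * K.coe.edgeSet.ncard := by
    have h5 := K.coe.sum_degrees_eq_twice_card_edges
    rw [← coe_edgeFinset, Set.ncard_coe_finset, ← h5,
      Finset.sum_subtype S (p := fun v => v ∈ K.verts) (fun v => by simp [hv])]
    refine Fintype.sum_congr _ _ fun v => ?_
    rw [Subgraph.coe_degree, ← Subgraph.finset_card_neighborSet_eq_degree]
    congr 1
    ext u
    have hvS : v.1 ∈ S := v.2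
    simp [K, hvS]
  rw [h4]
  push_cast
  rw [← h2, h3]
  gcongr

theorem maxAvgDegree_nonneg [Finite V] [Nonempty V] : 0 ≤ G.maxAvgDegree := by
  refine le_trans ?_ (avgDegree_le_maxAvgDegree (⊤ : G.Subgraph) Set.univ_nonempty)
  unfold avgDegree
  positivity

/-- The `3 * |W|` edges between `A` and `W` bound the average degree of the subgraph induced by
`A ∪ W` from below. -/
theorem six_mul_card_le [Finite V] {d : ℝ} (hG : G.maxAvgDegree ≤ d) {A W : Finset V}
    (hAW : Disjoint A W) (h : ∀ w ∈ W, 3 ≤ (G.nbrsIn A w).card) :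
    6 * (W.card : ℝ) ≤ d * (A.card + W.card) := by
  classical
  have h1 := sum_card_nbrsIn_le hG (A ∪ W)
  rw [Finset.card_union_of_disjoint hAW, Finset.sum_union hAW] at h1
  have h2 : ∑ w ∈ W, 3 ≤ ∑ w ∈ W, (G.nbrsIn A w).card := Finset.sum_le_sum h
  have h3 : ∑ w ∈ W, (G.nbrsIn A w).card ≤ ∑ w ∈ W, (G.nbrsIn (A ∪ W) w).card :=
    Finset.sum_le_sum fun w _ => Finset.card_le_card (nbrsIn_mono Finset.subset_union_left w)
  have h4 : ∑ a ∈ A, (G.nbrsIn W a).card ≤ ∑ a ∈ A, (G.nbrsIn (A ∪ W) a).card :=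
    Finset.sum_le_sum fun w _ => Finset.card_le_card (nbrsIn_mono Finset.subset_union_right w)
  rw [← sum_card_nbrsIn_comm] at h4
  simp only [Finset.sum_const, smul_eq_mul] at h2
  have h5 : 6 * W.card ≤
      ∑ v ∈ A, (G.nbrsIn (A ∪ W) v).card + ∑ v ∈ W, (G.nbrsIn (A ∪ W) v).card := by omega
  have h6 : (6 : ℝ) * W.card ≤
      ((∑ v ∈ A, (G.nbrsIn (A ∪ W) v).card + ∑ v ∈ W, (G.nbrsIn (A ∪ W) v).card : ℕ) : ℝ) := by
    exact_mod_cast h5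
  push_cast at h1 h6
  linarith

theorem exists_card_nbrsIn_le_five [Finite V] (hG : G.maxAvgDegree < 6) {S : Finset V}
    (hS : S.Nonempty) : ∃ v ∈ S, (G.nbrsIn S v).card ≤ 5 := by
  by_contra! h
  have h1 := sum_card_nbrsIn_le le_rfl (G := G) S
  have h2 : ∑ v ∈ S, 6 ≤ ∑ v ∈ S, (G.nbrsIn S v).card := Finset.sum_le_sum h
  have h3 : (0 : ℝ) < S.card := by exact_mod_cast hS.card_pos
  simp only [Finset.sum_const, smul_eq_mul] at h2
  have h4 : (S.card : ℝ) * 6 ≤ ((∑ v ∈ S, (G.nbrsIn S v).card : ℕ) : ℝ) := by exact_mod_cast h2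
  nlinarith

/-- If every edge has an end in `T` and the vertices of `T` have degree at most `3`, then every
subgraph has at most three times as many edges as vertices. -/
theorem maxAvgDegree_le_six [Finite V] [Nonempty V] (T : Set V)
    (hT : ∀ u v, G.Adj u v → u ∈ T ∨ v ∈ T)
    (hdeg : ∀ t ∈ T, (G.neighborSet t).ncard ≤ 3) : G.maxAvgDegree ≤ 6 := by
  classical
  have := Fintype.ofFinite V
  refine csSup_le ⟨_, ⊤, Set.univ_nonempty, rfl⟩ ?_
  rintro _ ⟨S, hS, rfl⟩
  have hne := hS.to_subtype
  have hpos : (0 : ℝ) < Nat.card S.verts := by exact_mod_cast Nat.card_pos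
  rw [avgDegree, div_le_iff₀ hpos]
  have key : S.coe.edgeFinset ⊆
      (Finset.univ.filter fun v : S.verts => v.1 ∈ T).biUnion fun v => S.coe.incidenceFinset v := by
    intro e he
    induction e with | _ u v
    simp only [mem_edgeFinset, mem_edgeSet] at he
    simp only [Finset.mem_biUnion, Finset.mem_filter, Finset.mem_univ, true_and,
      mem_incidenceFinset]
    rcases hT u v (S.adj_sub he) with h | h
    · exact ⟨u, h, he, by simp⟩
    · exact ⟨v, h, he, by simp⟩
  have h1 := (Finset.card_le_card key).trans (Finset.card_biUnion_le_card_mul _ _ 3 ?_)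
  · have h2 : S.coe.edgeSet.ncard ≤ Nat.card S.verts * 3 := by
      rw [← coe_edgeFinset, Set.ncard_coe_finset]
      refine h1.trans (Nat.mul_le_mul_right _ ?_)
      rw [Nat.card_eq_fintype_card]
      exact Finset.card_le_univ _
    have h3 : (S.coe.edgeSet.ncard : ℝ) ≤ Nat.card S.verts * 3 := by exact_mod_cast h2
    linarith
  · intro v hv
    rw [card_incidenceFinset_eq_degree, Subgraph.coe_degree,
      ← Subgraph.finset_card_neighborSet_eq_degree, ← Set.ncard_eq_toFinset_card']
    exact (Set.ncard_le_ncard (S.neighborSet_subset _)).trans (hdeg v.1 (by simpa using hv))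

/-! ### Large independent sets -/

/-- The greedy bound of Caro and Wei inside a finite set `S`. -/
theorem exists_isIndepSet_sum_inv_le (S : Finset V) :
    ∃ I ⊆ S, G.IsIndepSet (I : Set V) ∧
      ∑ v ∈ S, (1 : ℝ) / ((G.nbrsIn S v).card + 1) ≤ I.card := by
  classical
  induction S using Finset.strongInduction with | _ S ih
  rcases S.eq_empty_or_nonempty with rfl | hS
  · exact ⟨∅, subset_rfl, by simp, by simp⟩
  obtain ⟨v, hv, hmin⟩ := S.exists_min_image (fun v => (G.nbrsIn S v).card) hS
  set B := insert v (G.nbrsIn S v) with hB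
  have hBS : B ⊆ S := Finset.insert_subset hv (nbrsIn_subset S v)
  obtain ⟨I, hIS, hI, hcard⟩ := ih (S \ B) (Finset.sdiff_ssubset hBS ⟨v, by simp [hB]⟩)
  have hvI : v ∉ I := fun h => by simpa [hB] using hIS h
  refine ⟨insert v I, Finset.insert_subset hv (hIS.trans Finset.sdiff_subset), ?_, ?_⟩
  · have hnot : ∀ u ∈ I, ¬ G.Adj v u := fun u hu h => by
      have := hIS hu
      simp only [hB, Finset.mem_sdiff, Finset.mem_insert, mem_nbrsIn, not_or, not_and] at this
      exact this.2.2 this.1 h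
    intro x hx y hy hxy
    simp only [Finset.coe_insert, Set.mem_insert_iff, Finset.mem_coe] at hx hy
    rcases hx with rfl | hx <;> rcases hy with rfl | hy
    · exact (hxy rfl).elim
    · exact hnot y hy
    · exact fun h => hnot x hx h.symm
    · exact hI hx hy hxy
  · rw [Finset.card_insert_of_notMem hvI, ← Finset.sum_sdiff hBS]
    push_cast
    have h1 : ∑ u ∈ S \ B, (1 : ℝ) / ((G.nbrsIn S u).card + 1) ≤
        ∑ u ∈ S \ B, (1 : ℝ) / ((G.nbrsIn (S \ B) u).card + 1) := by
      refine Finset.sum_le_sum fun u _ => ?_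
      have := Finset.card_le_card (nbrsIn_mono (G := G) (S := S \ B) Finset.sdiff_subset u)
      gcongr
    -- The degrees on `B` are at least that of `v`, and `B` has one element more than that
    have h2 : ∑ u ∈ B, (1 : ℝ) / ((G.nbrsIn S u).card + 1) ≤ 1 := by
      have : ∀ u ∈ B, (1 : ℝ) / ((G.nbrsIn S u).card + 1) ≤ 1 / ((G.nbrsIn S v).card + 1) := by
        intro u hu
        have := hmin u (hBS hu)
        gcongr
      refine (Finset.sum_le_sum this).trans ?_
      have hc : B.card = (G.nbrsIn S v).card + 1 := by
        rw [hB, Finset.card_insert_of_notMem (by simp)]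
      rw [Finset.sum_const, hc, nsmul_eq_mul]
      push_cast
      rw [mul_one_div_cancel (by positivity)]
    linarith

/-- Turán's bound on the independence number, inside a finite set `S`. -/
theorem exists_isIndepSet_sq_card_le (S : Finset V) :
    ∃ I ⊆ S, G.IsIndepSet (I : Set V) ∧
      S.card ^ 2 ≤ I.card * (S.card + ∑ v ∈ S, (G.nbrsIn S v).card) := by
  obtain ⟨I, hIS, hI, h⟩ := G.exists_isIndepSet_sum_inv_le S
  refine ⟨I, hIS, hI, ?_⟩
  rcases S.eq_empty_or_nonempty with rfl | hS
  · simp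
  have h1 := Finset.sq_sum_div_le_sum_sq_div S (fun _ => (1 : ℝ))
    (g := fun v => ((G.nbrsIn S v).card : ℝ) + 1) (fun _ _ => by positivity)
  simp only [Finset.sum_const, nsmul_eq_mul, mul_one, one_pow, Finset.sum_add_distrib] at h1
  have h2 := h1.trans h
  have : (0 : ℝ) < S.card := by exact_mod_cast hS.card_pos
  rw [div_le_iff₀ (by positivity), add_comm (∑ v ∈ S, _)] at h2
  exact_mod_cast h2

end

open scoped Classical in
/-- The elements of `S` in the closed neighborhood of `v`. -/
noncomputable def closedNbrsIn {V : Type} (G : SimpleGraph V) (S : Finset V) (v : V) : Finset V :=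
  {u ∈ S | u = v ∨ G.Adj v u}

/-- The graph joining the distinct vertices at distance at most two; its independent sets are the
2-independent sets of `G`. -/
def distTwoGraph {V : Type} (G : SimpleGraph V) : SimpleGraph V where
  Adj u v := u ≠ v ∧ ¬ 2 < G.edist u v
  symm := ⟨fun u v h => ⟨h.1.symm, by rw [G.edist_comm]; exact h.2⟩⟩
  loopless := ⟨fun _ h => h.1 rfl⟩

section

variable {V : Type} {G : SimpleGraph V}

@[simp] theorem mem_closedNbrsIn {S : Finset V} {u v : V} :
    u ∈ G.closedNbrsIn S v ↔ u ∈ S ∧ (u = v ∨ G.Adj v u) := by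
  simp [closedNbrsIn]

theorem closedNbrsIn_mono {S T : Finset V} (h : S ⊆ T) (v : V) :
    G.closedNbrsIn S v ⊆ G.closedNbrsIn T v :=
  fun u hu => by simp only [mem_closedNbrsIn] at hu ⊢; exact ⟨h hu.1, hu.2⟩

/-! ### Domination and 2-independence numbers -/

theorem dominationNumber_le_card {D : Finset V} (hD : G.IsDominatingSet D) :
    G.dominationNumber ≤ D.card :=
  Nat.sInf_le ⟨D, hD, rfl⟩

theorem exists_card_eq_dominationNumber [Finite V] (G : SimpleGraph V) :
    ∃ D : Finset V, G.IsDominatingSet D ∧ D.card = G.dominationNumber := by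
  have := Fintype.ofFinite V
  exact Nat.sInf_mem (s := {n | ∃ D : Finset V, G.IsDominatingSet D ∧ D.card = n})
    ⟨_, Finset.univ, fun v => .inl (Finset.mem_univ v), rfl⟩

theorem card_le_twoIndepNumber [Finite V] {A : Finset V} (hA : G.IsTwoIndepSet A) :
    A.card ≤ G.twoIndepNumber := by
  have := Fintype.ofFinite V
  refine le_csSup ⟨Fintype.card V, ?_⟩ ⟨A, hA, rfl⟩
  rintro _ ⟨B, -, rfl⟩
  exact Finset.card_le_univ B

theorem twoIndepNumber_le {n : ℕ} (h : ∀ A : Finset V, G.IsTwoIndepSet A → A.card ≤ n) :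
    G.twoIndepNumber ≤ n := by
  refine csSup_le ⟨_, ∅, by simp [IsTwoIndepSet], rfl⟩ ?_
  rintro _ ⟨A, hA, rfl⟩
  exact h A hA

theorem two_lt_edist_iff_forall {u v : V} :
    2 < G.edist u v ↔ u ≠ v ∧ ¬ G.Adj u v ∧ ∀ z, G.Adj u z → ¬ G.Adj v z := by
  rw [two_lt_edist_iff, Set.eq_empty_iff_forall_notMem]
  simp [mem_commonNeighbors]

theorem isTwoIndepSet_iff_isIndepSet_distTwoGraph {A : Finset V} :
    G.IsTwoIndepSet A ↔ G.distTwoGraph.IsIndepSet (A : Set V) := by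
  refine ⟨fun h u hu v hv huv hadj => hadj.2 (h u hu v hv huv), fun h u hu v hv huv => ?_⟩
  by_contra hlt
  exact h hu hv huv ⟨huv, hlt⟩

/-! ### Scattered sets and dominating sets in degenerate graphs -/

/-- In a `k`-degenerate graph, a set `R` is dominated by at most `(k + 1) * |X|` vertices, for some
`X ⊆ R` that has at most `k + 1` elements in each closed neighborhood. With the vertices added one
by one, each with at most `k` earlier neighbors, an undominated vertex of `R` is put into `X`, and
it and its earlier neighbors into `D`: a vertex gets a later neighbor in `X` at most once, as it
then enters `D`. -/
theorem exists_scattered_dominating {k : ℕ}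
    (hG : ∀ S : Finset V, S.Nonempty → ∃ v ∈ S, (G.nbrsIn S v).card ≤ k) (R S : Finset V) :
    ∃ X D : Finset V, X ⊆ R ∧ X ⊆ D ∧ D ⊆ S ∧
      (∀ v ∈ R, v ∈ S → v ∈ D ∨ ∃ u ∈ D, G.Adj v u) ∧ D.card ≤ (k + 1) * X.card ∧
      (∀ v ∈ S, (G.closedNbrsIn X v).card ≤ k + 1) ∧
      ∀ v ∈ S, v ∉ D → (G.closedNbrsIn X v).card ≤ k := by
  classical
  induction S using Finset.strongInduction with | _ S ih
  rcases S.eq_empty_or_nonempty with rfl | hS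
  · exact ⟨∅, ∅, by simp⟩
  obtain ⟨v, hv, hdeg⟩ := hG S hS
  obtain ⟨X, D, hXR, hXD, hDS, hdom, hcard, hle, hlt⟩ :=
    ih (S.erase v) (Finset.erase_ssubset hv)
  have hvD : v ∉ D := fun h => by simpa using hDS h
  have hvX : v ∉ X := fun h => hvD (hXD h)
  have hXS : X ⊆ S := hXD.trans (hDS.trans (Finset.erase_subset v S))
  have hvcl : G.closedNbrsIn X v ⊆ G.nbrsIn S v := by
    intro u hu
    simp only [mem_closedNbrsIn, mem_nbrsIn] at hu ⊢
    rcases hu with ⟨hu, rfl | h⟩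
    · exact (hvX hu).elim
    · exact ⟨hXS hu, h⟩
  have hvk := (Finset.card_le_card hvcl).trans hdeg
  by_cases hcase : v ∈ R ∧ ∀ u ∈ D, ¬ G.Adj v u
  · obtain ⟨hvR, hun⟩ := hcase
    have hvN : v ∉ G.nbrsIn S v := by simp
    refine ⟨insert v X, D ∪ insert v (G.nbrsIn S v), Finset.insert_subset hvR hXR, ?_, ?_, ?_, ?_,
      ?_, ?_⟩
    · intro u hu
      rcases Finset.mem_insert.1 hu with rfl | hu
      · simp
      · exact Finset.mem_union_left _ (hXD hu)
    · exact Finset.union_subset (hDS.trans (Finset.erase_subset v S))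
        (Finset.insert_subset hv (nbrsIn_subset S v))
    · intro u huR huS
      by_cases huv : u = v
      · exact .inl (by simp [huv])
      · rcases hdom u huR (Finset.mem_erase.2 ⟨huv, huS⟩) with h | ⟨w, hw, h⟩
        · exact .inl (Finset.mem_union_left _ h)
        · exact .inr ⟨w, Finset.mem_union_left _ hw, h⟩
    · have := Finset.card_union_le D (insert v (G.nbrsIn S v))
      rw [Finset.card_insert_of_notMem hvN] at this
      rw [Finset.card_insert_of_notMem hvX]
      linarith
    · intro u hu
      have hsub : G.closedNbrsIn (insert v X) u ⊆ insert v (G.closedNbrsIn X u) := by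
        intro w hw
        simp only [mem_closedNbrsIn, Finset.mem_insert] at hw ⊢
        tauto
      have h1 := (Finset.card_le_card hsub).trans (Finset.card_insert_le _ _)
      by_cases huv : u = v
      · subst huv
        omega
      have huS := Finset.mem_erase.2 ⟨huv, hu⟩
      by_cases hadj : G.Adj v u
      · have := hlt u huS fun h => hun u h hadj
        omega
      · refine (Finset.card_le_card fun w hw => ?_).trans (hle u huS)
        simp only [mem_closedNbrsIn, Finset.mem_insert] at hw ⊢
        rcases hw with ⟨rfl | hw, rfl | h⟩
        · exact (huv rfl).elim
        · exact (hadj h.symm).elim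
        · exact ⟨hw, .inl rfl⟩
        · exact ⟨hw, .inr h⟩
    · intro u hu hnot
      simp only [Finset.mem_union, Finset.mem_insert, mem_nbrsIn, not_or, not_and] at hnot
      refine (Finset.card_le_card fun w hw => ?_).trans
        (hlt u (Finset.mem_erase.2 ⟨hnot.2.1, hu⟩) hnot.1)
      simp only [mem_closedNbrsIn, Finset.mem_insert] at hw ⊢
      rcases hw with ⟨rfl | hw, rfl | h⟩
      · exact (hnot.2.1 rfl).elim
      · exact (hnot.2.2 hu h.symm).elim
      · exact ⟨hw, .inl rfl⟩
      · exact ⟨hw, .inr h⟩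
  · refine ⟨X, D, hXR, hXD, hDS.trans (Finset.erase_subset v S), ?_, hcard, ?_, ?_⟩
    · intro u huR huS
      by_cases huv : u = v
      · subst huv
        push Not at hcase
        exact .inr (hcase huR)
      · exact hdom u huR (Finset.mem_erase.2 ⟨huv, huS⟩)
    · intro u hu
      by_cases huv : u = v
      · subst huv
        omega
      · exact hle u (Finset.mem_erase.2 ⟨huv, hu⟩)
    · intro u hu hnot
      by_cases huv : u = v
      · subst huv
        exact hvk
      · exact hlt u (Finset.mem_erase.2 ⟨huv, hu⟩) hnot

/-- A scattered set `X` as large as the domination number up to a constant, with a set `D` of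
similar size that is disjoint from `X` and dominates all the vertices outside `X`. -/
theorem exists_scattered_disjoint_dominating [Finite V] {k : ℕ}
    (hG : ∀ S : Finset V, S.Nonempty → ∃ v ∈ S, (G.nbrsIn S v).card ≤ k) :
    ∃ X D : Finset V, Disjoint X D ∧ (∀ v ∉ X, v ∈ D ∨ ∃ u ∈ D, G.Adj v u) ∧
      D.card ≤ 2 * (k + 1) ^ 2 * X.card ∧ G.dominationNumber ≤ 2 * (k + 1) ^ 2 * X.card ∧
      ∀ v, (G.closedNbrsIn X v).card ≤ k + 1 := by
  classical
  have := Fintype.ofFinite V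
  obtain ⟨X, D, -, hXD, -, hdom, hcard, hle, -⟩ :=
    exists_scattered_dominating hG Finset.univ Finset.univ
  simp only [Finset.mem_univ, true_implies] at hdom hle
  have hγ : G.dominationNumber ≤ D.card := dominationNumber_le_card hdom
  -- the vertices outside `D` that `X` alone dominates: either few vertices suffice to dominate
  -- them and replace `X` in `D`, or they contain a large scattered set
  set R : Finset V := {v | v ∉ D ∧ ∀ u ∈ D \ X, ¬ G.Adj v u} with hR
  obtain ⟨Y, E, hYR, -, -, hdomE, hcardE, hleY, -⟩ :=
    exists_scattered_dominating hG R Finset.univ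
  simp only [Finset.mem_univ, true_implies] at hdomE hleY
  by_cases hE : 2 * E.card ≤ X.card
  · have hX : X.card ≤ 2 * (X \ E).card := by
      have := Finset.le_card_sdiff E X
      omega
    have hpow : (k + 1) * (2 * (X \ E).card) ≤ 2 * (k + 1) ^ 2 * (X \ E).card := by
      rw [← mul_assoc, mul_comm (k + 1) 2]
      gcongr
      exact Nat.le_self_pow two_ne_zero _
    have hmul := Nat.mul_le_mul_left (k + 1) hX
    refine ⟨X \ E, D \ X ∪ E, ?_, ?_, ?_, ?_, ?_⟩
    · rw [Finset.disjoint_left]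
      intro u hu
      simp only [Finset.mem_sdiff, Finset.mem_union] at hu ⊢
      tauto
    · intro v hv
      by_cases hvX : v ∈ X
      · refine .inl (Finset.mem_union_right _ ?_)
        by_contra h
        exact hv (Finset.mem_sdiff.2 ⟨hvX, h⟩)
      by_cases hvD : v ∈ D
      · exact .inl (Finset.mem_union_left _ (Finset.mem_sdiff.2 ⟨hvD, hvX⟩))
      by_cases hvR : v ∈ R
      · rcases hdomE v hvR with h | ⟨u, hu, h⟩
        · exact .inl (Finset.mem_union_right _ h)
        · exact .inr ⟨u, Finset.mem_union_right _ hu, h⟩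
      · simp only [hR, Finset.mem_filter, Finset.mem_univ, true_and, not_and] at hvR
        have h := hvR hvD
        push Not at h
        obtain ⟨u, hu, h⟩ := h
        exact .inr ⟨u, Finset.mem_union_left _ hu, h⟩
    · have h1 := Finset.card_union_le (D \ X) E
      have h2 := Finset.card_sdiff_add_card_eq_card hXD
      omega
    · omega
    · exact fun v => (Finset.card_le_card (closedNbrsIn_mono Finset.sdiff_subset v)).trans (hle v)
  · have hX : X.card ≤ 2 * (k + 1) * Y.card := by linarith
    have hD : D.card ≤ 2 * (k + 1) ^ 2 * Y.card :=
      hcard.trans ((Nat.mul_le_mul_left (k + 1) hX).trans (by ring_nf; rfl))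
    have hYD : ∀ v ∈ Y, v ∉ D := fun v hv => by
      have := hYR hv
      simp only [hR, Finset.mem_filter] at this
      exact this.2.1
    exact ⟨Y, D, Finset.disjoint_left.2 hYD, fun v _ => hdom v, hD, hγ.trans hD, hleY⟩

/-! ### The domination number is linear in the 2-independence number -/

/-- Pairs in `X` at distance at most two lie in a common closed neighborhood, whose center can be
taken in `Z`; so they are few. -/
theorem sum_card_nbrsIn_distTwoGraph_le {X Z : Finset V} {k : ℕ} (hXZ : X ⊆ Z)
    (hZ : ∀ z ∉ Z, (G.nbrsIn X z).card ≤ 1) (hk : ∀ z ∈ Z, (G.closedNbrsIn X z).card ≤ k) :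
    ∑ v ∈ X, (G.distTwoGraph.nbrsIn X v).card ≤ Z.card * k ^ 2 := by
  classical
  rw [← Finset.card_sigma]
  have hsub : X.sigma (fun v => G.distTwoGraph.nbrsIn X v) ⊆
      Z.biUnion fun z => (G.closedNbrsIn X z).sigma fun _ => G.closedNbrsIn X z := by
    rintro ⟨x, y⟩ hxy
    simp only [Finset.mem_sigma, mem_nbrsIn, Finset.mem_biUnion, mem_closedNbrsIn] at hxy ⊢
    obtain ⟨hx, hy, hne, hdist⟩ := hxy
    rw [two_lt_edist_iff_forall] at hdist
    by_cases hadj : G.Adj x y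
    · exact ⟨x, hXZ hx, ⟨hx, .inl rfl⟩, hy, .inr hadj⟩
    push Not at hdist
    obtain ⟨z, hxz, hyz⟩ := hdist hne hadj
    refine ⟨z, ?_, ⟨hx, .inr hxz.symm⟩, hy, .inr hyz.symm⟩
    by_contra hzZ
    exact hne (Finset.card_le_one.1 (hZ z hzZ) x (by simp [hx, hxz.symm]) y
      (by simp [hy, hyz.symm]))
  refine (Finset.card_le_card hsub).trans (Finset.card_biUnion_le_card_mul _ _ _ fun z hz => ?_)
  rw [Finset.card_sigma, Finset.sum_const, smul_eq_mul, sq]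
  exact Nat.mul_le_mul (hk z hz) (hk z hz)

/-- The scattered set `X` for `k = 5` has size at least `γ / 72`. With `Z = X ∪ D ∪ W` of size at
most `6 / (6 - d) * 73 |X|`, at most `36 |Z|` ordered pairs in `X` are at distance
at most two. -/
theorem dominationNumber_le_mul_twoIndepNumber [Finite V] {d : ℝ} (hd : d < 6)
    (hG : G.maxAvgDegree ≤ d) :
    (G.dominationNumber : ℝ) ≤ 72 * (1 + 36 * (6 / (6 - d)) * 73) * G.twoIndepNumber := by
  classical
  have := Fintype.ofFinite V
  have hd' : 0 < 6 - d := by linarith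
  obtain ⟨X, D, hXD, hdom, hcard, hγ, hk⟩ := exists_scattered_disjoint_dominating (k := 5)
    fun S hS => exists_card_nbrsIn_le_five (hG.trans_lt hd) hS
  norm_num at hcard hγ hk
  set W : Finset V := {w | w ∉ X ∪ D ∧ 2 ≤ (G.nbrsIn X w).card} with hW
  have hdisj : Disjoint (X ∪ D) W := by
    rw [Finset.disjoint_right]
    intro w hw
    simp only [hW, Finset.mem_filter] at hw
    exact hw.2.1
  -- a vertex of `W` has two neighbors in `X` and another one in `D`
  have hW6 := six_mul_card_le hG hdisj fun w hw => by
    simp only [hW, Finset.mem_filter, Finset.mem_univ, true_and, Finset.mem_union, not_or] at hw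
    rcases hdom w hw.1.1 with h | ⟨u, hu, h⟩
    · exact (hw.1.2 h).elim
    have huX : u ∉ G.nbrsIn X w := fun hu' =>
      Finset.disjoint_left.1 hXD (nbrsIn_subset _ _ hu') hu
    have hsub : insert u (G.nbrsIn X w) ⊆ G.nbrsIn (X ∪ D) w :=
      Finset.insert_subset (by simp [hu, h]) (nbrsIn_mono Finset.subset_union_left w)
    have := Finset.card_le_card hsub
    rw [Finset.card_insert_of_notMem huX] at this
    omega
  have hpairs := sum_card_nbrsIn_distTwoGraph_le (G := G) (X := X) (Z := (X ∪ D) ∪ W) (k := 6)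
    (Finset.subset_union_left.trans Finset.subset_union_left)
    (fun z hz => by
      simp only [Finset.mem_union, hW, Finset.mem_filter, Finset.mem_univ, true_and, not_or,
        not_and] at hz
      have := hz.2 hz.1
      omega)
    fun z _ => hk z
  obtain ⟨I, -, hI, hsq⟩ := G.distTwoGraph.exists_isIndepSet_sq_card_le X
  have hα := card_le_twoIndepNumber (isTwoIndepSet_iff_isIndepSet_distTwoGraph.2 hI)
  rw [Finset.card_union_of_disjoint hdisj, Finset.card_union_of_disjoint hXD] at hpairs
  rw [Finset.card_union_of_disjoint hXD] at hW6
  have hZ : ((X.card + D.card + W.card : ℕ) : ℝ) ≤ 6 / (6 - d) * (73 * X.card) := by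
    have hD : (D.card : ℝ) ≤ 72 * X.card := by exact_mod_cast hcard
    rw [div_mul_eq_mul_div, le_div_iff₀ hd']
    push_cast at hW6 ⊢
    linarith
  have hsq' : (X.card : ℝ) ^ 2 ≤
      I.card * (X.card + ((X.card + D.card + W.card : ℕ) : ℝ) * 36) := by
    exact_mod_cast hsq.trans (Nat.mul_le_mul_left _ (Nat.add_le_add_left hpairs _))
  have hXI : (X.card : ℝ) ≤ (1 + 36 * (6 / (6 - d)) * 73) * I.card := by
    rcases (Nat.cast_nonneg (α := ℝ) X.card).eq_or_lt with h0 | hpos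
    · rw [← h0]
      positivity
    refine le_of_mul_le_mul_left ?_ hpos
    have := mul_le_mul_of_nonneg_left hZ (Nat.cast_nonneg (α := ℝ) I.card)
    nlinarith
  have hγ' : (G.dominationNumber : ℝ) ≤ 72 * X.card := by exact_mod_cast hγ
  have hα' : (I.card : ℝ) ≤ G.twoIndepNumber := by exact_mod_cast hα
  calc (G.dominationNumber : ℝ) ≤ 72 * ((1 + 36 * (6 / (6 - d)) * 73) * I.card) := by linarith
    _ = 72 * (1 + 36 * (6 / (6 - d)) * 73) * I.card := by ring
    _ ≤ _ := by gcongr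

end

end SimpleGraph

namespace Cascade

section

variable {V : Type} {H : SimpleGraph V}

/-! ### The slope of a cascade -/

/-- Edges of the foundation come from vertices of color `e`, and each of these gives one edge. -/
theorem sum_card_nbrsIn_foundation_le [Fintype V] (C : Cascade H) {E : Finset V}
    (hE : ∀ z, z ∈ E ↔ C.color z = .e) (S : Finset {x : V // C.color x = .v}) :
    ∑ x ∈ S, (C.foundation.nbrsIn S x).card ≤ E.card * 2 := by
  classical
  rw [← Finset.card_sigma]
  let N : V → Finset {x : V // C.color x = .v} := fun z => {x | H.Adj z x}
  have hN : ∀ z ∈ E, (N z).card = 2 := by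
    intro z hz
    rw [← C.two_v z ((hE z).1 hz), ← Finset.card_map (Function.Embedding.subtype _),
      ← Set.ncard_coe_finset]
    congr 1
    ext y
    simp [N]
  refine (Finset.card_le_card (t := E.biUnion fun z => (N z).offDiag.map
    ⟨fun p => (⟨p.1, p.2⟩ : Σ _ : {x : V // C.color x = .v}, {x : V // C.color x = .v}),
      fun p q h => by cases p; cases q; simpa using h⟩) ?_).trans
    (Finset.card_biUnion_le_card_mul _ _ _ fun z hz => ?_)
  · rintro ⟨x, y⟩ hxy
    simp only [Finset.mem_sigma, SimpleGraph.mem_nbrsIn] at hxy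
    obtain ⟨-, -, hne, z, hxz, hyz⟩ := hxy
    have hz : C.color z = .e := by
      rcases C.no_other _ _ hxz with h | h
      · rw [x.2] at h; cases h
      · exact h
    simp only [Finset.mem_biUnion, Finset.mem_map, Finset.mem_offDiag]
    exact ⟨z, (hE z).2 hz, (x, y), by simp [N, hxz.symm, hyz.symm, hne], rfl⟩
  · rw [Finset.card_map, Finset.offDiag_card, hN z hz]

theorem slope_le [Finite V] [Nonempty V] (C : Cascade H) {d : ℝ} (hd : d < 6)
    (hH : H.maxAvgDegree ≤ d) : C.slope ≤ 24 / (6 - d) - 3 := by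
  classical
  have := Fintype.ofFinite V
  have hd0 : 0 ≤ d := SimpleGraph.maxAvgDegree_nonneg.trans hH
  have hd' : 0 < 6 - d := by linarith
  set A : Finset V := {x | C.color x = .v} with hA
  set B : Finset V := {x | C.color x = .d} with hB
  set E : Finset V := {x | C.color x = .e} with hE
  have hAn : {x | C.color x = .v}.ncard = A.card := by
    rw [← Set.ncard_coe_finset]; simp [hA]
  have hBn : {x | C.color x = .d}.ncard = B.card := by
    rw [← Set.ncard_coe_finset]; simp [hB]
  have hAB : Disjoint A B := by
    simp only [Finset.disjoint_left, hA, hB, Finset.mem_filter, Finset.mem_univ, true_and]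
    intro x hx hx'
    rw [hx] at hx'; cases hx'
  have hABE : Disjoint (A ∪ B) E := by
    simp only [Finset.disjoint_left, Finset.mem_union, hA, hB, hE, Finset.mem_filter,
      Finset.mem_univ, true_and]
    rintro x (hx | hx) hx' <;> rw [hx] at hx' <;> cases hx'
  have hdeg := SimpleGraph.six_mul_card_le hH hABE fun z hz => by
    have hz' : C.color z = .e := by simpa [hE] using hz
    have h1 : (H.nbrsIn A z).card = 2 := by
      rw [← C.two_v z hz', ← Set.ncard_coe_finset]
      congr 1; ext y; simp [hA, and_comm]
    have h2 : (H.nbrsIn B z).card = 1 := by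
      rw [← C.one_d z hz', ← Set.ncard_coe_finset]
      congr 1; ext y; simp [hB, and_comm]
    have h3 : Disjoint (H.nbrsIn A z) (H.nbrsIn B z) :=
      hAB.mono (SimpleGraph.nbrsIn_subset _ _) (SimpleGraph.nbrsIn_subset _ _)
    have h4 := Finset.card_le_card (Finset.union_subset
      (SimpleGraph.nbrsIn_mono (G := H) (Finset.subset_union_left (s₁ := A) (s₂ := B)) z)
      (SimpleGraph.nbrsIn_mono (G := H) (Finset.subset_union_right (s₁ := A) (s₂ := B)) z))
    rw [Finset.card_union_of_disjoint h3, h1, h2] at h4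
    exact h4
  rw [Finset.card_union_of_disjoint hAB] at hdeg
  obtain ⟨I, -, hI, hsq⟩ := C.foundation.exists_isIndepSet_sq_card_le Finset.univ
  have hsum := C.sum_card_nbrsIn_foundation_le (E := E) (fun z => by simp [hE]) Finset.univ
  have hcard : (Finset.univ : Finset {x : V // C.color x = .v}).card = A.card := by
    rw [Finset.card_univ, Fintype.card_subtype]
  rw [hcard] at hsq
  rw [slope, hAn, hBn]
  set t := max C.foundation.indepNum B.card with ht
  have hIt : I.card ≤ t := (hI.card_le_indepNum).trans (le_max_left _ _)
  have hBt : B.card ≤ t := le_max_right _ _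
  have hsq' : A.card ^ 2 ≤ t * (A.card + E.card * 2) :=
    hsq.trans (Nat.mul_le_mul hIt (Nat.add_le_add_left hsum _))
  rw [show 24 / (6 - d) - 3 = (6 + 3 * d) / (6 - d) by field_simp; ring]
  have hsqR : (A.card : ℝ) ^ 2 ≤ t * (A.card + E.card * 2) := by exact_mod_cast hsq'
  have hBtR : (B.card : ℝ) ≤ t := by exact_mod_cast hBt
  push_cast at hdeg
  clear_value t
  generalize (A.card : ℝ) = a, (B.card : ℝ) = b, (E.card : ℝ) = m at *
  rcases (Nat.cast_nonneg (α := ℝ) t).eq_or_lt with h0 | htpos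
  · rw [← h0, div_zero]
    positivity
  rw [div_le_div_iff₀ htpos hd']
  rcases le_or_gt a t with hat | hat
  · nlinarith
  · have hapos : 0 < a := htpos.trans hat
    have hm : m * (6 - d) ≤ 2 * d * a := by nlinarith
    refine le_of_mul_le_mul_left ?_ hapos
    nlinarith [mul_le_mul_of_nonneg_left hm htpos.le, mul_le_mul_of_nonneg_right hsqR hd'.le]

end

end Cascade

section

open SimpleGraph

/-! ### The subdivided cliques with an apex -/

instance (n : ℕ) : Finite (subdividedCliqueApex n).V := (subdividedCliqueApex n).finite

instance (n : ℕ) : Nonempty (subdividedCliqueApex n).V := (subdividedCliqueApex n).nonempty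

variable {n : ℕ}

/-- The vertices of the clique, as vertices of `subdividedCliqueApex n`. -/
def cliqueVertex (v : Fin n) : (subdividedCliqueApex n).V := some (.inl v)

/-- The subdivision vertices of `subdividedCliqueApex n`. -/
def subdivisionVertex (e : (⊤ : SimpleGraph (Fin n)).edgeSet) : (subdividedCliqueApex n).V :=
  some (.inr e)

/-- The vertex of `subdividedCliqueApex n` adjacent to all the subdivision vertices. -/
def apexVertex : (subdividedCliqueApex n).V := none

theorem adj_apexVertex_subdivisionVertex (e : (⊤ : SimpleGraph (Fin n)).edgeSet) :
    (subdividedCliqueApex n).graph.Adj (subdivisionVertex e) apexVertex := ⟨e, rfl⟩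

theorem adj_subdividedCliqueApex {x y : (subdividedCliqueApex n).V}
    (h : (subdividedCliqueApex n).graph.Adj x y) :
    (∃ e, x = subdivisionVertex e ∧ (y = apexVertex ∨ ∃ v ∈ e.1, y = cliqueVertex v)) ∨
      ∃ e, y = subdivisionVertex e ∧ (x = apexVertex ∨ ∃ v ∈ e.1, x = cliqueVertex v) := by
  rcases x with _ | x | e <;> rcases y with _ | y | f
  · exact h.elim
  · obtain ⟨e, he⟩ := h
    cases he
  · exact .inr ⟨f, rfl, .inl rfl⟩
  · obtain ⟨e, he⟩ := h
    cases he
  · exact h.elim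
  · exact .inr ⟨f, rfl, .inr ⟨x, h, rfl⟩⟩
  · exact .inl ⟨e, rfl, .inl rfl⟩
  · exact .inl ⟨e, rfl, .inr ⟨y, h, rfl⟩⟩
  · exact h.elim

theorem subdividedCliqueApex_cases (x : (subdividedCliqueApex n).V) :
    x = apexVertex ∨ (∃ v, x = cliqueVertex v) ∨ ∃ e, x = subdivisionVertex e := by
  rcases x with _ | x | e
  · exact .inl rfl
  · exact .inr (.inl ⟨x, rfl⟩)
  · exact .inr (.inr ⟨e, rfl⟩)

theorem maxAvgDegree_subdividedCliqueApex_le (n : ℕ) :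
    (subdividedCliqueApex n).graph.maxAvgDegree ≤ 6 := by
  classical
  refine maxAvgDegree_le_six (Set.range subdivisionVertex) ?_ ?_
  · intro u v h
    rcases adj_subdividedCliqueApex h with ⟨e, rfl, -⟩ | ⟨e, rfl, -⟩
    · exact .inl ⟨e, rfl⟩
    · exact .inr ⟨e, rfl⟩
  · rintro _ ⟨⟨e, he⟩, rfl⟩
    induction e with | _ a b
    refine le_trans (Set.ncard_le_ncard (t := (({apexVertex, cliqueVertex a, cliqueVertex b} :
      Finset (subdividedCliqueApex n).V) : Set (subdividedCliqueApex n).V)) ?_) ?_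
    · intro y hy
      rcases adj_subdividedCliqueApex hy with ⟨f, hf, hy⟩ | ⟨f, -, hx | ⟨v, -, hx⟩⟩
      · cases hf
        rcases hy with rfl | ⟨v, hv, rfl⟩
        · simp
        · rcases Sym2.mem_iff.1 hv with rfl | rfl <;> simp
      · cases hx
      · cases hx
    · rw [Set.ncard_coe_finset]
      exact Finset.card_le_three

/-- Two clique vertices have a common neighbor, and so have two subdivision vertices, and a clique
vertex and the apex. -/
theorem edist_subdividedCliqueApex_le (hn : 2 ≤ n) {x y : (subdividedCliqueApex n).V} (hxy : x ≠ y)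
    (h : (x ∈ Set.range subdivisionVertex ↔ y ∈ Set.range (subdivisionVertex (n := n)))) :
    ¬ 2 < (subdividedCliqueApex n).graph.edist x y := by
  rw [two_lt_edist_iff_forall]
  rintro ⟨-, -, hz⟩
  have hedge : ∀ u v : Fin n, u ≠ v →
      ∃ e, (subdividedCliqueApex n).graph.Adj (cliqueVertex u) (subdivisionVertex e) ∧
        (subdividedCliqueApex n).graph.Adj (cliqueVertex v) (subdivisionVertex e) :=
    fun u v huv => ⟨⟨s(u, v), huv⟩, Sym2.mem_mk_left u v, Sym2.mem_mk_right u v⟩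
  have hother : ∀ v : Fin n, ∃ u, u ≠ v := by
    have : Nontrivial (Fin n) := Fin.nontrivial_iff_two_le.2 hn
    exact fun v => exists_ne v
  rcases subdividedCliqueApex_cases x with rfl | ⟨u, rfl⟩ | ⟨e, rfl⟩ <;>
    rcases subdividedCliqueApex_cases y with rfl | ⟨v, rfl⟩ | ⟨f, rfl⟩
  · exact hxy rfl
  · obtain ⟨u, hu⟩ := hother v
    obtain ⟨e, -, he⟩ := hedge u v hu
    exact hz _ (adj_apexVertex_subdivisionVertex e).symm he
  · obtain ⟨e, he⟩ := h.2 ⟨f, rfl⟩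
    cases he
  · obtain ⟨v, hv⟩ := hother u
    obtain ⟨e, -, he⟩ := hedge v u hv
    exact hz _ he (adj_apexVertex_subdivisionVertex e).symm
  · obtain ⟨e, he, he'⟩ := hedge u v (by rintro rfl; exact hxy rfl)
    exact hz _ he he'
  · obtain ⟨e, he⟩ := h.2 ⟨f, rfl⟩
    cases he
  · obtain ⟨f, hf⟩ := h.1 ⟨e, rfl⟩
    cases hf
  · obtain ⟨f, hf⟩ := h.1 ⟨e, rfl⟩
    cases hf
  · exact hz _ (adj_apexVertex_subdivisionVertex e) (adj_apexVertex_subdivisionVertex f)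

theorem twoIndepNumber_subdividedCliqueApex (hn : 3 ≤ n) :
    (subdividedCliqueApex n).graph.twoIndepNumber = 2 := by
  classical
  apply le_antisymm
  · refine twoIndepNumber_le fun A hA => ?_
    by_contra! hcard
    -- among three vertices, two agree on being subdivision vertices
    obtain ⟨x, hx, y, hy, hxy, h⟩ := Finset.exists_ne_map_eq_of_card_lt_of_maps_to
      (s := A) (t := (Finset.univ : Finset Bool)) (by simpa using hcard)
      (f := fun x => decide (x ∈ Set.range subdivisionVertex)) (fun _ _ => Finset.mem_univ _)
    exact edist_subdividedCliqueApex_le (by omega) hxy (by simpa using h) (hA x hx y hy hxy)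
  · -- a clique vertex, and the subdivision vertex of an edge that avoids it
    let a : Fin n := ⟨0, by omega⟩
    let b : Fin n := ⟨1, by omega⟩
    let c : Fin n := ⟨2, by omega⟩
    let e : (⊤ : SimpleGraph (Fin n)).edgeSet := ⟨s(b, c), by simp [b, c]⟩
    have hae : a ∉ e.1 := by simp [a, b, c, e]
    have hne : cliqueVertex a ≠ subdivisionVertex e := by rintro ⟨⟩
    have hdist : 2 < (subdividedCliqueApex n).graph.edist (cliqueVertex a)
        (subdivisionVertex e) := by
      refine two_lt_edist_iff_forall.2 ⟨hne, hae, fun z h1 h2 => ?_⟩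
      rcases adj_subdividedCliqueApex h1 with ⟨f, hf, -⟩ | ⟨f, rfl, -⟩
      · cases hf
      · exact h2
    rw [← Finset.card_pair hne]
    refine card_le_twoIndepNumber fun u hu v hv huv => ?_
    simp only [Finset.mem_insert, Finset.mem_singleton] at hu hv
    rcases hu with rfl | rfl <;> rcases hv with rfl | rfl
    · exact (huv rfl).elim
    · exact hdist
    · rw [edist_comm]
      exact hdist
    · exact (huv rfl).elim

/-- A vertex dominates at most two clique vertices. -/
theorem le_two_mul_dominationNumber_subdividedCliqueApex (n : ℕ) :
    n ≤ 2 * (subdividedCliqueApex n).graph.dominationNumber := by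
  classical
  obtain ⟨D, hD, hcard⟩ := exists_card_eq_dominationNumber (subdividedCliqueApex n).graph
  let N : (subdividedCliqueApex n).V → Finset (Fin n) := fun x =>
    {v | cliqueVertex v = x ∨ (subdividedCliqueApex n).graph.Adj (cliqueVertex v) x}
  have hcover : (Finset.univ : Finset (Fin n)) ⊆ D.biUnion N := by
    intro v _
    rcases hD (cliqueVertex v) with h | ⟨u, hu, h⟩
    · exact Finset.mem_biUnion.2 ⟨_, h, by simp [N]⟩
    · exact Finset.mem_biUnion.2 ⟨u, hu, by simp [N, h]⟩
  have hN : ∀ x ∈ D, (N x).card ≤ 2 := by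
    intro x _
    rcases subdividedCliqueApex_cases x with rfl | ⟨u, rfl⟩ | ⟨⟨e, he⟩, rfl⟩
    · refine (Finset.card_le_card (t := ∅) fun v hv => ?_).trans (by simp)
      rcases (Finset.mem_filter.1 hv).2 with h | ⟨e, he⟩
      · cases h
      · cases he
    · refine (Finset.card_le_card (t := {u}) fun v hv => ?_).trans (by simp)
      rcases (Finset.mem_filter.1 hv).2 with h | h
      · cases h
        simp
      · exact h.elim
    · induction e with | _ a b
      refine (Finset.card_le_card (t := {a, b}) fun v hv => ?_).trans Finset.card_le_two
      rcases (Finset.mem_filter.1 hv).2 with h | h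
      · cases h
      · have h' : v ∈ s(a, b) := h
        simpa using h'
  have := (Finset.card_le_card hcover).trans (Finset.card_biUnion_le_card_mul _ _ _ hN)
  rw [Finset.card_univ, Fintype.card_fin, hcard] at this
  omega

end

theorem corollary5 (d : ℝ) :
    (d < 6 →
      HasBoundedDominationRatio (maxAvgDegreeClass d) ∧
      ∀ G ∈ maxAvgDegreeClass d, ∀ C : Cascade G.graph, C.slope ≤ 24 / (6 - d) - 3) ∧
    (6 ≤ d →
      ¬ HasDominationTied (maxAvgDegreeClass d) ∧
      ∀ n : ℕ, 4 ≤ n →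
        subdividedCliqueApex n ∈ maxAvgDegreeClass d ∧
        (subdividedCliqueApex n).graph.twoIndepNumber = 2 ∧
        (n : ℝ) / 2 ≤ ((subdividedCliqueApex n).graph.dominationNumber : ℝ)) := by
  refine ⟨fun hd => ⟨⟨72 * (1 + 36 * (6 / (6 - d)) * 73), ?_⟩, fun G hG C => ?_⟩, fun hd => ?_⟩
  · rintro _ ⟨G, hG, rfl⟩
    have := G.finite
    have hd' : 0 < 6 - d := by linarith
    exact div_le_of_le_mul₀ (by positivity) (by positivity)
      (SimpleGraph.dominationNumber_le_mul_twoIndepNumber hd hG)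
  · have := G.finite
    have := G.nonempty
    exact C.slope_le hd hG
  · have hmem : ∀ n, subdividedCliqueApex n ∈ maxAvgDegreeClass d := fun n =>
      (maxAvgDegree_subdividedCliqueApex_le n).trans hd
    have hγ : ∀ n : ℕ,
        (n : ℝ) / 2 ≤ ((subdividedCliqueApex n).graph.dominationNumber : ℝ) := fun n => by
      have : (n : ℝ) ≤ 2 * ((subdividedCliqueApex n).graph.dominationNumber : ℝ) := by
        exact_mod_cast le_two_mul_dominationNumber_subdividedCliqueApex n
      linarith
    refine ⟨?_, fun n hn => ⟨hmem n, twoIndepNumber_subdividedCliqueApex (by omega), hγ n⟩⟩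
    rintro ⟨h, hh⟩
    obtain ⟨n, hn⟩ := exists_nat_gt (2 * h 2)
    have h1 := hh _ (hmem (n + 3))
    rw [twoIndepNumber_subdividedCliqueApex (by omega)] at h1
    have h2 := hγ (n + 3)
    push_cast at h2
    linarith
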